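/- Let $\bar r,\bar a,\underline d,\bar d$ be constants with $\underline d>0$. There is a constant $C$, depending only on $\bar r,\bar a,\underline d,\bar d$, such that the following holds for all $m,n\in\mathbb N^+$. Let $\mathcal D=\{(r_j,\boldsymbol a_j)\}_{j=1}^n$, with $r_j\in\mathbb R$, $\boldsymbol a_j=(a_{1j},\dots,a_{mj})^\top\in\mathbb R^m$, $|r_j|\le\bar r$ and $\|\boldsymbol a_j\|_\infty\le\bar a$ for all $j$ (the data need not be nonnegative), and let $\boldsymbol d\in\mathbb R^m$ with $\underline d\le d_i\le\bar d$ for all $i$, and $\boldsymbol b=n\boldsymbol d$. Assume that the data are in general position: for every price vector $\boldsymbol p\ge\boldsymbol 0$ there are at most $m$ indices $j$ with $\boldsymbol a_j^\top\boldsymbol p=r_j$. Let $$R_n^*=\max\Big\{\sum_{j=1}^n r_jx_j:\ \sum_{j=1}^n a_{ij}x_j\le b_i\ (1\le i\le m),\ 0\le x_j\le1\Big\}.$$ The columns arrive in a uniformly random order, i.e. the column arriving at time $t$ is $(r_{\sigma(t)},\boldsymbol a_{\sigma(t)})$ for a uniformly random permutation $\sigma$ of $\{1,\dots,n\}$. The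 Dynamic Learning Algorithm starts with $\boldsymbol p_1=\boldsymbol 0$; at time $t=1,\dots,n$ it sets $x_t=1$ if $r_{\sigma(t)}>\boldsymbol a_{\sigma(t)}^\top\boldsymbol p_t$ and $x_t=0$ otherwise, and then it chooses, as a function of the $t$ columns observed so far, an optimal solution of the scaled dual problem $$\boldsymbol p_{t+1}\in\operatorname*{arg\,min}_{\boldsymbol p\ge\boldsymbol 0}\ \boldsymbol d^\top\boldsymbol p+\frac1t\sum_{j=1}^t\big(r_{\sigma(j)}-\boldsymbol a_{\sigma(j)}^\top\boldsymbol p\big)^+ .$$ Then, however these optimal solutions are chosen, $R_n=\sum_{t=1}^n r_{\sigma(t)}x_t$ satisfies $$R_n^*-\mathbb E[R_n]\le C\sqrt{mn},$$ and, if $n\ge2$, the expected constraint violation satisfies, componentwise, $$\mathbb E\Big[\sum_{t=1}^n a_{i\sigma(t)}x_t-b_i\Big]\le C\sqrt{mn}\,\log n\qquad(1\le i\le m).$$ Both expectations are over the random permutation $\sigma$. -/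

import Mathlib

open scoped BigOperators

namespace OnlineLP

/-- One column of the linear program: the reward `r_j` together with the constraint
coefficients `a_j = (a_{1j}, …, a_{mj})`. -/
abbrev Column (m : ℕ) : Type := ℝ × (Fin m → ℝ)

/-- The inner product `a_jᵀ p` of the coefficients of a column with a price vector. -/
def cost {m : ℕ} (c : Column m) (p : Fin m → ℝ) : ℝ := ∑ i, c.2 i * p i

/-- The feasible set of the LP relaxation: `A x ≤ b`, `0 ≤ x ≤ 1`. -/
def primalFeasible {m n : ℕ} (z : Fin n → Column m) (b : Fin m → ℝ) : Set (Fin n → ℝ) :=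
  {x | (∀ j, 0 ≤ x j ∧ x j ≤ 1) ∧ ∀ i, ∑ j, (z j).2 i * x j ≤ b i}

/-- The optimal value `max rᵀ x` of the LP relaxation. For `b ≥ 0` the feasible set is compact and
contains `0`, so that the supremum is a maximum. -/
noncomputable def primalValue {m n : ℕ} (z : Fin n → Column m) (b : Fin m → ℝ) : ℝ :=
  sSup ((fun x : Fin n → ℝ => ∑ j, (z j).1 * x j) '' primalFeasible z b)

/-- The objective of the scaled dual problem of the first `t` columns,
`dᵀ p + (1/t) ∑_{j ≤ t} (r_j - a_jᵀ p)⁺`. -/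
noncomputable def dualObjective {m t : ℕ} (d : Fin m → ℝ) (z : Fin t → Column m)
    (p : Fin m → ℝ) : ℝ :=
  ∑ i, d i * p i + (1 / (t : ℝ)) * ∑ j, max ((z j).1 - cost (z j) p) 0

/-- `p` is an optimal solution of the scaled dual problem, i.e. it minimizes the dual objective
over the nonnegative orthant. -/
def IsDualOptimal {m t : ℕ} (d : Fin m → ℝ) (z : Fin t → Column m) (p : Fin m → ℝ) : Prop :=
  (∀ i, 0 ≤ p i) ∧
    ∀ q : Fin m → ℝ, (∀ i, 0 ≤ q i) → dualObjective d z p ≤ dualObjective d z q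

/-- A solver for the scaled dual problems: to each nonempty history of observed columns it
assigns an optimal dual solution (with an arbitrary choice among several optimal ones). -/
def IsDualSolver {m : ℕ} (d : Fin m → ℝ)
    (solve : (t : ℕ) → (Fin t → Column m) → (Fin m → ℝ)) : Prop :=
  ∀ (t : ℕ) (z : Fin t → Column m), 1 ≤ t → IsDualOptimal d z (solve t z)

/-- The dual price that the Dynamic Learning Algorithm uses in the period `t`, where the
periods are numbered from `0`: the price is `0` in the first period and afterwards the optimal
dual solution for the `t` columns that arrived before. -/
def dlaPrice {m n : ℕ} (solve : (t : ℕ) → (Fin t → Column m) → (Fin m → ℝ))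
    (z : Fin n → Column m) (t : Fin n) : Fin m → ℝ :=
  if t.val = 0 then 0 else solve t.val (fun j => z (Fin.castLE t.isLt.le j))

open Classical in
/-- The output of the Dynamic Learning Algorithm on the columns `z` in their order of arrival:
`x_t = 1` if `r_t > a_tᵀ p_t` and `x_t = 0` otherwise. -/
noncomputable def dlaOutput {m n : ℕ} (solve : (t : ℕ) → (Fin t → Column m) → (Fin m → ℝ))
    (z : Fin n → Column m) (t : Fin n) : ℝ :=
  if cost (z t) (dlaPrice solve z t) < (z t).1 then 1 else 0

/-- The reward `R_n = ∑_t r_t x_t` collected by the Dynamic Learning Algorithm. -/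
noncomputable def dlaReward {m n : ℕ} (solve : (t : ℕ) → (Fin t → Column m) → (Fin m → ℝ))
    (z : Fin n → Column m) : ℝ :=
  ∑ t, (z t).1 * dlaOutput solve z t

/-- The vector `A x - b` for the output `x` of the Dynamic Learning Algorithm. -/
noncomputable def dlaExcess {m n : ℕ} (solve : (t : ℕ) → (Fin t → Column m) → (Fin m → ℝ))
    (z : Fin n → Column m) (b : Fin m → ℝ) (i : Fin m) : ℝ :=
  ∑ t, (z t).2 i * dlaOutput solve z t - b i

open Classical in
/-- The columns are in general position: for each price vector `p ≥ 0` at most `m` of them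
satisfy `a_jᵀ p = r_j`. -/
def GeneralPosition {m n : ℕ} (z : Fin n → Column m) : Prop :=
  ∀ p : Fin m → ℝ, (∀ i, 0 ≤ p i) →
    (Finset.univ.filter fun j => cost (z j) p = (z j).1).card ≤ m

end OnlineLP

/-!
A dual optimal price accepts, on the sample it was learned from, an allocation that meets the
budget and earns the sample optimum, up to the at most `m` tied columns: this is the first-order
optimality condition, and the ties cost `O(min (m / t) 1) = O(√(m / t))`. In the reward the sample
optimum is compared with a fixed optimal solution of the full program, whose sample consumption
misses the budget by `O(√(m / t))` in Euclidean norm, valued at prices whose sum is bounded because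
the budget is bounded below.

It remains to pass from the sample to the next arrival. Since the price of period `t` is fixed by
the first `t` arrivals, the next arrival may be replaced by any of the `n - t` later ones. Swapping
`k = min t (n - t)` pairs of past and later arrivals by independent fair coins preserves the uniform
law and turns the difference of the two averages into a Rademacher average over a class of threshold
functions of VC dimension at most `m`. Chaining bounds it by `O(√(m / k))` without a logarithm, and
summing over the periods gives `O(√(m n))`, for the constraint violation as well.
-/

namespace OnlineLP

open Finset
open scoped symmDiff

section VCDimension

variable {ι : Type*} [DecidableEq ι] {𝒜 : Finset (Finset ι)} {L Y : Finset ι}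

theorem subset_of_shatters_image_inter (hL : (𝒜.image (· ∩ Y)).Shatters L) : L ⊆ Y := by
  obtain ⟨B, hB, hLB⟩ := hL.exists_superset
  obtain ⟨A, -, rfl⟩ := mem_image.1 hB
  exact hLB.trans inter_subset_right

theorem shatters_of_shatters_image_inter (hL : (𝒜.image (· ∩ Y)).Shatters L) :
    𝒜.Shatters L := by
  intro t ht
  obtain ⟨B, hB, rfl⟩ := hL ht
  obtain ⟨A, hA, rfl⟩ := mem_image.1 hB
  refine ⟨A, hA, ?_⟩
  rw [inter_left_comm, inter_eq_left.2 (subset_of_shatters_image_inter hL), inter_comm]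

/-- The Sauer–Shelah lemma in exponential form: bounding `x ^ vcDim` by the weight `x ^ #L` of each
shattered set replaces the sum of binomial coefficients by a single power. -/
theorem card_mul_pow_vcDim_le (hY : Set.InjOn (· ∩ Y) (𝒜 : Set (Finset ι))) {x : ℝ} (hx : 0 ≤ x)
    (hx1 : x ≤ 1) : #𝒜 * x ^ 𝒜.vcDim ≤ (1 + x) ^ #Y := by
  set ℬ := 𝒜.image (· ∩ Y)
  have hcard : #𝒜 ≤ #ℬ.shatterer :=
    (card_image_of_injOn hY).ge.trans (card_le_card_shatterer ℬ)
  have hdim : ∀ L ∈ ℬ.shatterer, #L ≤ 𝒜.vcDim := fun L hL =>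
    (shatters_of_shatters_image_inter (mem_shatterer.1 hL)).card_le_vcDim
  have hsub : ℬ.shatterer ⊆ Y.powerset := fun L hL =>
    mem_powerset.2 (subset_of_shatters_image_inter (mem_shatterer.1 hL))
  calc #𝒜 * x ^ 𝒜.vcDim ≤ #ℬ.shatterer * x ^ 𝒜.vcDim := by gcongr
    _ = ∑ _L ∈ ℬ.shatterer, x ^ 𝒜.vcDim := by rw [sum_const, nsmul_eq_mul]
    _ ≤ ∑ L ∈ ℬ.shatterer, x ^ #L :=
        sum_le_sum fun L hL => pow_le_pow_of_le_one hx hx1 (hdim L hL)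
    _ ≤ ∑ L ∈ Y.powerset, x ^ #L :=
        sum_le_sum_of_subset_of_nonneg hsub fun _ _ _ => by positivity
    _ = (1 + x) ^ #Y := by
        rw [add_comm, ← sum_pow_mul_eq_add_pow]
        simp only [one_pow, mul_one]

variable [Fintype ι] [Nonempty ι]

-- A uniformly random sample of size `q` misses a given `S k` with probability at most `exp (-δ q)`.
theorem exists_hitting_set {κ : Type*} (I : Finset κ) (S : κ → Finset ι) {δ : ℝ}
    (hS : ∀ k ∈ I, δ * Fintype.card ι ≤ #(S k)) (q : ℕ) (hq : #I * Real.exp (-(δ * q)) < 1) :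
    ∃ Y : Finset ι, #Y ≤ q ∧ ∀ k ∈ I, (S k ∩ Y).Nonempty := by
  by_contra! hcon
  have hcover : (univ : Finset (Fin q → ι)) ⊆
      I.biUnion fun k => Fintype.piFinset fun _ => (S k)ᶜ := by
    intro f _
    obtain ⟨k, hk, hmiss⟩ := hcon (univ.image f) (by simpa using card_image_le (s := univ) (f := f))
    refine mem_biUnion.2 ⟨k, hk, Fintype.mem_piFinset.2 fun a => mem_compl.2 fun ha => ?_⟩
    exact notMem_empty (f a) (hmiss ▸ mem_inter.2 ⟨ha, mem_image_of_mem f (mem_univ a)⟩)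
  have hcount : Fintype.card ι ^ q ≤ ∑ k ∈ I, #(S k)ᶜ ^ q := by
    simpa using (card_le_card hcover).trans card_biUnion_le
  have hmiss : ∀ k ∈ I, (#(S k)ᶜ : ℝ) ≤ Fintype.card ι * Real.exp (-δ) := by
    intro k hk
    rw [card_compl, Nat.cast_sub (card_le_univ _)]
    have hexp : 1 - δ ≤ Real.exp (-δ) := Real.one_sub_le_exp_neg δ
    nlinarith [hS k hk, (Nat.cast_nonneg (Fintype.card ι) : (0 : ℝ) ≤ _)]
  have : (0 : ℝ) < (Fintype.card ι : ℝ) ^ q := by positivity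
  refine lt_irrefl ((Fintype.card ι : ℝ) ^ q) ?_
  calc (Fintype.card ι : ℝ) ^ q ≤ ∑ k ∈ I, (#(S k)ᶜ : ℝ) ^ q := mod_cast hcount
    _ ≤ ∑ _k ∈ I, (Fintype.card ι * Real.exp (-δ)) ^ q := by gcongr with k hk; exact hmiss k hk
    _ = #I * Real.exp (-(δ * q)) * (Fintype.card ι : ℝ) ^ q := by
        rw [sum_const, nsmul_eq_mul, mul_pow, ← Real.exp_nat_mul]; ring_nf
    _ < 1 * (Fintype.card ι : ℝ) ^ q := by gcongr
    _ = (Fintype.card ι : ℝ) ^ q := one_mul _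

theorem exists_injOn_inter {δ : ℝ}
    (hsep : ∀ A ∈ 𝒜, ∀ B ∈ 𝒜, A ≠ B → δ * Fintype.card ι ≤ #(A ∆ B)) (h𝒜 : 𝒜.Nonempty) (q : ℕ)
    (hq : 2 * Real.log #𝒜 ≤ δ * q) :
    ∃ Y : Finset ι, #Y ≤ q ∧ Set.InjOn (· ∩ Y) (𝒜 : Set (Finset ι)) := by
  have hpos : (0 : ℝ) < #𝒜 := mod_cast h𝒜.card_pos
  have hpairs : (#𝒜.offDiag : ℝ) < (#𝒜 : ℝ) ^ 2 := by
    rw [offDiag_card, Nat.cast_sub (Nat.le_mul_self _)]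
    push_cast
    linarith [sq (#𝒜 : ℝ)]
  have hexp : (#𝒜 : ℝ) ^ 2 ≤ Real.exp (δ * q) := by
    rw [← Real.log_le_iff_le_exp (by positivity), Real.log_pow]
    exact_mod_cast hq
  obtain ⟨Y, hYq, hY⟩ := exists_hitting_set 𝒜.offDiag (fun P => P.1 ∆ P.2)
    (fun P hP => by
      obtain ⟨hA, hB, hAB⟩ := mem_offDiag.1 hP
      exact hsep _ hA _ hB hAB) q
    (by
      rw [Real.exp_neg, ← div_eq_mul_inv, div_lt_one (Real.exp_pos _)]
      exact hpairs.trans_le hexp)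
  refine ⟨Y, hYq, fun A hA B hB (hAB : A ∩ Y = B ∩ Y) => by_contra fun hne => ?_⟩
  refine (hY (A, B) (mem_offDiag.2 ⟨hA, hB, hne⟩)).ne_empty ?_
  ext k
  have hk := Finset.ext_iff.1 hAB k
  simp only [mem_inter, mem_symmDiff, notMem_empty, iff_false] at hk ⊢
  tauto

/-- Dudley's packing bound: a sample just large enough to separate the members of `𝒜` has size
proportional to `log #𝒜`, whereas by Sauer–Shelah it carries few traces of `𝒜`. -/
theorem log_card_le_of_separated {δ : ℝ} (hδ : 0 < δ) (hδ1 : δ ≤ 1)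
    (hsep : ∀ A ∈ 𝒜, ∀ B ∈ 𝒜, A ≠ B → δ * Fintype.card ι ≤ #(A ∆ B)) (h𝒜 : 𝒜.Nonempty) :
    Real.log #𝒜 ≤ 2 * 𝒜.vcDim * Real.log (4 / δ) + 1 / 2 := by
  have hpos : (0 : ℝ) < #𝒜 := mod_cast h𝒜.card_pos
  have : 0 ≤ Real.log #𝒜 := Real.log_natCast_nonneg _
  set q := ⌈2 * Real.log #𝒜 / δ⌉₊
  have hq : q ≤ 2 * Real.log #𝒜 / δ + 1 := (Nat.ceil_lt_add_one (by positivity)).le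
  obtain ⟨Y, hYq, hY⟩ := exists_injOn_inter hsep h𝒜 q
    (by rw [mul_comm δ, ← div_le_iff₀ hδ]; exact Nat.le_ceil _)
  have htraces : #𝒜 * (δ / 4) ^ 𝒜.vcDim ≤ Real.exp (δ / 4 * q) := by
    calc #𝒜 * (δ / 4) ^ 𝒜.vcDim ≤ (1 + δ / 4) ^ #Y :=
          card_mul_pow_vcDim_le hY (by positivity) (by linarith)
      _ ≤ (1 + δ / 4) ^ q := pow_le_pow_right₀ (by linarith) hYq
      _ ≤ Real.exp (δ / 4) ^ q := by
          gcongr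
          linarith [Real.add_one_le_exp (δ / 4)]
      _ = Real.exp (δ / 4 * q) := by rw [← Real.exp_nat_mul, mul_comm]
  have hloglog : Real.log #𝒜 - 𝒜.vcDim * Real.log (4 / δ) ≤ δ / 4 * q := by
    have hinv : Real.log (δ / 4) = -Real.log (4 / δ) := by rw [← Real.log_inv, inv_div]
    rw [← Real.log_le_iff_le_exp (by positivity), Real.log_mul hpos.ne' (by positivity),
      Real.log_pow, hinv] at htraces
    linarith
  have hsample : δ / 4 * q ≤ Real.log #𝒜 / 2 + 1 / 4 := by
    calc δ / 4 * q ≤ δ / 4 * (2 * Real.log #𝒜 / δ + 1) := by gcongr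
      _ = Real.log #𝒜 / 2 + δ / 4 := by field_simp; ring
      _ ≤ Real.log #𝒜 / 2 + 1 / 4 := by gcongr
  linarith

end VCDimension

section MaximalInequality

variable {Ω J : Type*} [Fintype Ω] [Nonempty Ω]

theorem map_expect_le_of_convexOn {S : Set ℝ} {f : ℝ → ℝ} (hf : ConvexOn ℝ S f) {X : Ω → ℝ}
    (hX : ∀ ω, X ω ∈ S) : f (𝔼 ω, X ω) ≤ 𝔼 ω, f (X ω) := by
  have hcard : (Fintype.card Ω : ℝ) ≠ 0 := by positivity
  simpa [Fintype.expect_eq_sum_div_card, div_eq_inv_mul, mul_sum] using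
    hf.map_sum_le (t := univ) (w := fun _ => (Fintype.card Ω : ℝ)⁻¹) (fun _ _ => by positivity)
      (by simp [hcard]) fun ω _ => hX ω

variable {T : Finset J} {X : J → Ω → ℝ} {s : ℝ} {sel : Ω → J}

theorem mul_expect_abs_le_log_card_add
    (hX : ∀ j ∈ T, ∀ a, 𝔼 ω, Real.exp (a * X j ω) ≤ Real.exp (a ^ 2 * s / 2))
    (hsel : ∀ ω, sel ω ∈ T) {a : ℝ} (ha : 0 ≤ a) :
    a * 𝔼 ω, |X (sel ω) ω| ≤ Real.log (2 * #T) + a ^ 2 * s / 2 := by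
  have hT : (0 : ℝ) < #T := mod_cast card_pos.2 ⟨_, hsel (Classical.arbitrary Ω)⟩
  have hpointwise : ∀ ω, Real.exp (a * |X (sel ω) ω|) ≤
      ∑ j ∈ T, (Real.exp (a * X j ω) + Real.exp (-a * X j ω)) := fun ω => by
    refine le_trans ?_ (single_le_sum (f := fun j => Real.exp (a * X j ω) + Real.exp (-a * X j ω))
      (fun j _ => by positivity) (hsel ω))
    simpa only [abs_mul, abs_of_nonneg ha, neg_mul] using Real.exp_abs_le (a * X (sel ω) ω)
  have hexp : Real.exp (a * 𝔼 ω, |X (sel ω) ω|) ≤ 2 * #T * Real.exp (a ^ 2 * s / 2) := by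
    calc Real.exp (a * 𝔼 ω, |X (sel ω) ω|) ≤ 𝔼 ω, Real.exp (a * |X (sel ω) ω|) := by
          rw [mul_expect]
          exact map_expect_le_of_convexOn convexOn_exp fun _ => Set.mem_univ _
      _ ≤ 𝔼 ω, ∑ j ∈ T, (Real.exp (a * X j ω) + Real.exp (-a * X j ω)) :=
          expect_le_expect fun ω _ => hpointwise ω
      _ = ∑ j ∈ T, (𝔼 ω, Real.exp (a * X j ω) + 𝔼 ω, Real.exp (-a * X j ω)) := by
          simp only [expect_sum_comm, expect_add_distrib]
      _ ≤ ∑ _j ∈ T, (Real.exp (a ^ 2 * s / 2) + Real.exp (a ^ 2 * s / 2)) := by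
          gcongr with j hj
          · exact hX j hj a
          · simpa only [neg_sq] using hX j hj (-a)
      _ = 2 * #T * Real.exp (a ^ 2 * s / 2) := by rw [sum_const, nsmul_eq_mul]; ring
  have hlog := (Real.le_log_iff_exp_le (by positivity)).2 hexp
  rwa [Real.log_mul (by positivity) (Real.exp_ne_zero _), Real.log_exp] at hlog

theorem expect_abs_le_sqrt_log_card
    (hX : ∀ j ∈ T, ∀ a, 𝔼 ω, Real.exp (a * X j ω) ≤ Real.exp (a ^ 2 * s / 2))
    (hsel : ∀ ω, sel ω ∈ T) (hs : 0 < s) :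
    𝔼 ω, |X (sel ω) ω| ≤ √(2 * s * Real.log (2 * #T)) := by
  have hT : 1 ≤ #T := card_pos.2 ⟨_, hsel (Classical.arbitrary Ω)⟩
  have hT' : (1 : ℝ) ≤ #T := mod_cast hT
  set l := Real.log (2 * #T)
  have hl : 0 < l := Real.log_pos (by linarith)
  -- `√(2 l / s)` minimises `l / a + a s / 2`.
  set a := √(2 * l / s)
  have ha : 0 < a := by positivity
  have hasq : a ^ 2 * s / 2 = l := by
    rw [Real.sq_sqrt (by positivity)]
    field_simp
  have haopt : a * √(2 * s * l) = 2 * l := by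
    rw [← Real.sqrt_mul (by positivity), show 2 * l / s * (2 * s * l) = (2 * l) ^ 2 by field_simp,
      Real.sqrt_sq (by positivity)]
  refine le_of_mul_le_mul_left ?_ ha
  calc a * 𝔼 ω, |X (sel ω) ω| ≤ l + a ^ 2 * s / 2 := mul_expect_abs_le_log_card_add hX hsel ha.le
    _ = a * √(2 * s * l) := by rw [hasq, haopt, two_mul]

end MaximalInequality

section Rademacher

/-- The sign `±1` encoded by a Boolean. Uniform random signs are uniform random Booleans. -/
def sgn (b : Bool) : ℝ := if b then 1 else -1

variable {ι : Type*} [Fintype ι]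

/-- The Rademacher sum of the coefficients `c` for the signs `ε`. -/
def rademacherSum (c : ι → ℝ) (ε : ι → Bool) : ℝ := ∑ k, sgn (ε k) * c k

theorem rademacherSum_add (c c' : ι → ℝ) (ε : ι → Bool) :
    rademacherSum (c + c') ε = rademacherSum c ε + rademacherSum c' ε := by
  simp only [rademacherSum, Pi.add_apply, mul_add, sum_add_distrib]

theorem rademacherSum_smul (a : ℝ) (c : ι → ℝ) (ε : ι → Bool) :
    rademacherSum (a • c) ε = a * rademacherSum c ε := by
  simp only [rademacherSum, Pi.smul_apply, smul_eq_mul, mul_sum, mul_left_comm]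

variable [DecidableEq ι]

theorem expect_exp_rademacherSum_le (c : ι → ℝ) :
    𝔼 ε, Real.exp (rademacherSum c ε) ≤ Real.exp ((∑ k, c k ^ 2) / 2) := by
  have hcosh : ∀ x, ∑ b, Real.exp (sgn b * x) = 2 * Real.cosh x := fun x => by
    rw [Fintype.sum_bool, Real.cosh_eq]
    simp only [sgn, if_true, Bool.false_eq_true, if_false, one_mul, neg_one_mul]
    ring
  have hprod : ∑ ε : ι → Bool, Real.exp (rademacherSum c ε) = ∏ k, (2 * Real.cosh (c k)) := by
    simp only [rademacherSum, Real.exp_sum, ← hcosh, prod_univ_sum, Fintype.piFinset_univ]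
  have hcard : (Fintype.card (ι → Bool) : ℝ) = ∏ _k : ι, (2 : ℝ) := by simp
  rw [Fintype.expect_eq_sum_div_card, hprod, hcard, prod_mul_distrib,
    mul_div_cancel_left₀ _ (by positivity), sum_div, Real.exp_sum]
  exact prod_le_prod (fun k _ => (Real.cosh_pos _).le) fun k _ => Real.cosh_le_exp_half_sq _

theorem expect_abs_rademacherSum_le {J : Type*} {T : Finset J} {c : J → ι → ℝ} {s : ℝ}
    (hs : 0 < s) (hc : ∀ j ∈ T, ∑ k, c j k ^ 2 ≤ s) {sel : (ι → Bool) → J}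
    (hsel : ∀ ε, sel ε ∈ T) :
    𝔼 ε, |rademacherSum (c (sel ε)) ε| ≤ √(2 * s * Real.log (2 * #T)) := by
  refine expect_abs_le_sqrt_log_card (X := fun j => rademacherSum (c j)) (fun j hj a => ?_) hsel hs
  simp only [← rademacherSum_smul]
  refine (expect_exp_rademacherSum_le _).trans (Real.exp_le_exp.2 ?_)
  simp only [Pi.smul_apply, smul_eq_mul, mul_pow, ← mul_sum]
  gcongr
  exact hc j hj

end Rademacher

section Chaining

theorem exists_subset_pairwise_of_symmetric {α : Type*} (s : Finset α) {R : α → α → Prop}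
    (hsymm : ∀ a b, R a b → R b a) (hirrefl : ∀ a, ¬R a a) :
    ∃ t ⊆ s, (t : Set α).Pairwise R ∧ ∀ a ∈ s, ∃ b ∈ t, ¬R a b := by
  classical
  have : Std.Symm R := ⟨hsymm⟩
  let F := s.powerset.filter fun t : Finset α => (t : Set α).Pairwise R
  obtain ⟨t, ht⟩ := F.exists_maximal ⟨∅, by simp [F]⟩
  obtain ⟨hts, hpair⟩ : t ⊆ s ∧ (t : Set α).Pairwise R := by simpa [F] using ht.prop
  refine ⟨t, hts, hpair, fun a ha => ?_⟩
  by_contra! hfar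
  have hinsert : insert a t ∈ F := by
    rw [mem_filter, mem_powerset, coe_insert, Set.pairwise_insert_of_symm]
    exact ⟨insert_subset ha hts, hpair, fun b hb _ => hfar b hb⟩
  exact hirrefl a (hfar a (ht.le_of_ge hinsert (subset_insert a t) (mem_insert_self a t)))

variable {ι : Type*} [Fintype ι] [DecidableEq ι] {w : ι → ℝ} {W : ℝ}

theorem sum_sq_indicator_sub_le (hw : ∀ k, |w k| ≤ W) (A B : Finset ι) :
    ∑ k, ((A : Set ι).indicator w k - (B : Set ι).indicator w k) ^ 2 ≤ W ^ 2 * #(A ∆ B) := by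
  calc ∑ k, ((A : Set ι).indicator w k - (B : Set ι).indicator w k) ^ 2
      ≤ ∑ k, if k ∈ A ∆ B then W ^ 2 else 0 := by
        refine sum_le_sum fun k _ => ?_
        have hsq : w k ^ 2 ≤ W ^ 2 := sq_le_sq.2 ((hw k).trans (le_abs_self W))
        by_cases hA : k ∈ A <;> by_cases hB : k ∈ B <;> simp [hA, hB, mem_symmDiff, hsq]
    _ = W ^ 2 * #(A ∆ B) := by rw [sum_ite_mem, univ_inter, sum_const, nsmul_eq_mul, mul_comm]

theorem expect_abs_rademacherSum_indicator_sub_le (hw : ∀ k, |w k| ≤ W) (hW : 0 < W)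
    {𝒜 : Finset (Finset ι)} {π : Finset ι → Finset ι} {s l : ℝ} (hs : 0 < s)
    (hπ : ∀ A ∈ 𝒜, #(A ∆ π A) ≤ s) (hl : Real.log (2 * #𝒜) ≤ l)
    {sel : (ι → Bool) → Finset ι} (hsel : ∀ ε, sel ε ∈ 𝒜) :
    𝔼 ε, |rademacherSum ((sel ε : Set ι).indicator w - (π (sel ε) : Set ι).indicator w) ε| ≤
      W * √(2 * s * l) := by
  calc 𝔼 ε, |rademacherSum ((sel ε : Set ι).indicator w - (π (sel ε) : Set ι).indicator w) ε|
      ≤ √(2 * (W ^ 2 * s) * Real.log (2 * #𝒜)) :=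
        expect_abs_rademacherSum_le
          (c := fun A : Finset ι => (A : Set ι).indicator w - (π A : Set ι).indicator w)
          (by positivity)
          (fun A hA => (sum_sq_indicator_sub_le hw A (π A)).trans (by gcongr; exact hπ A hA)) hsel
    _ ≤ √(W ^ 2 * (2 * s * l)) := by
        refine Real.sqrt_le_sqrt ?_
        rw [mul_left_comm, mul_assoc]
        gcongr
    _ = W * √(2 * s * l) := by rw [Real.sqrt_mul (by positivity), Real.sqrt_sq hW.le]

variable [Nonempty ι] {m : ℕ}

theorem exists_net {𝒜 : Finset (Finset ι)} (h𝒜 : 𝒜.vcDim ≤ m) (hm : 1 ≤ m) (k : ℕ) :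
    ∃ ℬ ⊆ 𝒜, (∀ A ∈ 𝒜, ∃ B ∈ ℬ, #(A ∆ B) ≤ (1 / 4 : ℝ) ^ k * Fintype.card ι) ∧
      Real.log (2 * #ℬ) ≤ 4 * m * (k + 1) := by
  obtain ⟨ℬ, hℬ𝒜, hsep, hcover⟩ := exists_subset_pairwise_of_symmetric 𝒜
    (R := fun A B => (1 / 4 : ℝ) ^ k * Fintype.card ι < #(A ∆ B))
    (fun A B h => by rwa [symmDiff_comm B]) fun A => by
      rw [not_lt, symmDiff_self, bot_eq_empty, card_empty, Nat.cast_zero]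
      positivity
  refine ⟨ℬ, hℬ𝒜, fun A hA => by simpa only [not_lt] using hcover A hA, ?_⟩
  obtain rfl | hne := ℬ.eq_empty_or_nonempty
  · simp only [card_empty, Nat.cast_zero, mul_zero, Real.log_zero]
    positivity
  have hm' : (1 : ℝ) ≤ m := mod_cast hm
  have hlog4 : Real.log (4 / (1 / 4) ^ k) = (k + 1) * (2 * Real.log 2) := by
    rw [show (4 / (1 / 4 : ℝ) ^ k) = 2 ^ (2 * (k + 1)) by rw [pow_mul, one_div_pow]; norm_num; ring,
      Real.log_pow]
    push_cast
    ring
  have hpacking : Real.log #ℬ ≤ 2 * m * ((k + 1) * (2 * Real.log 2)) + 1 / 2 := by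
    rw [← hlog4]
    refine (log_card_le_of_separated (δ := (1 / 4) ^ k) (by positivity)
      (pow_le_one₀ (by norm_num) (by norm_num)) (fun A hA B hB hAB => (hsep hA hB hAB).le)
      hne).trans ?_
    gcongr
    · rw [hlog4]; positivity
    · exact (vcDim_mono hℬ𝒜).trans h𝒜
  have hmk : (1 : ℝ) ≤ m * (k + 1) := one_le_mul_of_one_le_of_one_le hm' (by simp)
  rw [Real.log_mul two_ne_zero (mod_cast hne.card_pos.ne')]
  nlinarith [Real.log_two_lt_d9]

theorem sqrt_link_le {m N : ℝ} (hm : 0 ≤ m) (hN : 0 ≤ N) (k : ℕ) :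
    √(2 * ((1 / 4) ^ k * N) * (4 * m * (↑(k + 1) + 1))) ≤
      √(8 * m * N) * ((k + 2) * (1 / 2) ^ k) := by
  have hk : (k + 2 : ℝ) ≤ (k + 2) ^ 2 := le_self_pow₀ (by linarith) two_ne_zero
  have hquarter : (1 / 4 : ℝ) ^ k = ((1 / 2) ^ k) ^ 2 := by rw [pow_right_comm]; norm_num
  rw [← Real.sqrt_sq (by positivity : (0 : ℝ) ≤ (k + 2) * (1 / 2) ^ k),
    ← Real.sqrt_mul (by positivity)]
  refine Real.sqrt_le_sqrt ?_
  calc 2 * ((1 / 4 : ℝ) ^ k * N) * (4 * m * (↑(k + 1) + 1))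
      = 8 * m * N * ((k + 2) * ((1 / 2) ^ k) ^ 2) := by rw [hquarter]; push_cast; ring
    _ ≤ 8 * m * N * ((k + 2) ^ 2 * ((1 / 2) ^ k) ^ 2) := by gcongr
    _ = 8 * m * N * ((k + 2) * (1 / 2) ^ k) ^ 2 := by rw [mul_pow]

/-- Chaining along nets of radii `4⁻ᵏ`. The numbers `7 - 2 (k + 3) / 2 ^ k` are the partial sums of
`1 + ∑ j, (j + 2) / 2 ^ j`, whose terms bound the contributions of the successive links. -/
theorem expect_abs_rademacherSum_indicator_le_of_nets (hw : ∀ k, |w k| ≤ W) (hW : 0 < W)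
    {net : ℕ → Finset (Finset ι)}
    (hcover : ∀ k, ∀ A ∈ net (k + 1), ∃ B ∈ net k, #(A ∆ B) ≤ (1 / 4 : ℝ) ^ k * Fintype.card ι)
    (hlog : ∀ k, Real.log (2 * #(net k)) ≤ 4 * m * (k + 1)) (k : ℕ)
    {sel : (ι → Bool) → Finset ι} (hsel : ∀ ε, sel ε ∈ net k) :
    𝔼 ε, |rademacherSum ((sel ε : Set ι).indicator w) ε| ≤
      W * √(8 * m * Fintype.card ι) * (7 - 2 * (k + 3) * (1 / 2) ^ k) := by
  induction k generalizing sel with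
  | zero =>
    have hlink := expect_abs_rademacherSum_indicator_sub_le hw hW (π := fun _ => ∅)
      (s := Fintype.card ι) (by positivity) (fun A _ => mod_cast card_le_univ _) (hlog 0) hsel
    simp only [coe_empty, Set.indicator_empty', sub_zero] at hlink
    refine hlink.trans_eq ?_
    rw [show (2 * Fintype.card ι * (4 * m * ((0 : ℕ) + 1)) : ℝ) = 8 * m * Fintype.card ι by
      push_cast; ring]
    norm_num
  | succ k ih =>
    choose! π hπ hdist using hcover k
    have hlink := expect_abs_rademacherSum_indicator_sub_le hw hW (by positivity) hdist
      (hlog (k + 1)) hsel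
    calc 𝔼 ε, |rademacherSum ((sel ε : Set ι).indicator w) ε|
        ≤ 𝔼 ε, (|rademacherSum ((π (sel ε) : Set ι).indicator w) ε| +
          |rademacherSum ((sel ε : Set ι).indicator w - (π (sel ε) : Set ι).indicator w) ε|) := by
          refine expect_le_expect fun ε _ => ?_
          conv_lhs => rw [← add_sub_cancel ((π (sel ε) : Set ι).indicator w)
            ((sel ε : Set ι).indicator w), rademacherSum_add]
          exact abs_add_le _ _
      _ ≤ W * √(8 * m * Fintype.card ι) * (7 - 2 * (k + 3) * (1 / 2) ^ k) +
          W * (√(8 * m * Fintype.card ι) * ((k + 2) * (1 / 2) ^ k)) := by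
          rw [expect_add_distrib]
          gcongr
          · exact ih fun ε => hπ _ (hsel ε)
          · exact hlink.trans (by gcongr; exact sqrt_link_le (by positivity) (by positivity) k)
      _ = W * √(8 * m * Fintype.card ι) * (7 - 2 * (↑(k + 1) + 3) * (1 / 2) ^ (k + 1)) := by
          push_cast
          ring

theorem expect_abs_rademacherSum_indicator_le (hw : ∀ k, |w k| ≤ W) (hW : 0 < W)
    {𝒜 : Finset (Finset ι)} (h𝒜 : 𝒜.vcDim ≤ m) (hm : 1 ≤ m)
    {sel : (ι → Bool) → Finset ι} (hsel : ∀ ε, sel ε ∈ 𝒜) :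
    𝔼 ε, |rademacherSum ((sel ε : Set ι).indicator w) ε| ≤ 20 * W * √(m * Fintype.card ι) := by
  have hN : (0 : ℝ) < Fintype.card ι := by positivity
  choose net hsub hcover hlog using exists_net h𝒜 hm
  obtain ⟨k, hk⟩ := exists_pow_lt_of_lt_one (one_div_pos.2 hN) (show (1 / 4 : ℝ) < 1 by norm_num)
  have hfine : ∀ A ∈ 𝒜, A ∈ net k := fun A hA => by
    obtain ⟨B, hB, hAB⟩ := hcover k A hA
    have hcard : (#(A ∆ B) : ℝ) < 1 := hAB.trans_lt ((lt_div_iff₀ hN).1 hk)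
    have hbot : A ∆ B = ⊥ := card_eq_zero.1 (Nat.lt_one_iff.1 (mod_cast hcard))
    rwa [symmDiff_eq_bot.1 hbot]
  calc 𝔼 ε, |rademacherSum ((sel ε : Set ι).indicator w) ε|
      ≤ W * √(8 * m * Fintype.card ι) * (7 - 2 * (k + 3) * (1 / 2) ^ k) :=
        expect_abs_rademacherSum_indicator_le_of_nets hw hW
          (fun k A hA => hcover k A (hsub _ hA)) hlog k fun ε => hfine _ (hsel ε)
    _ ≤ W * √(8 * m * Fintype.card ι) * 7 :=
        mul_le_mul_of_nonneg_left (sub_le_self _ (by positivity)) (by positivity)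
    _ = W * (√8 * √(m * Fintype.card ι)) * 7 := by rw [mul_assoc 8, Real.sqrt_mul (by norm_num)]
    _ ≤ W * (20 / 7 * √(m * Fintype.card ι)) * 7 := by
        gcongr
        exact Real.sqrt_le_iff.2 (by norm_num)
    _ = 20 * W * √(m * Fintype.card ι) := by ring

end Chaining

section Thresholds

open Module

variable {E α ι : Type*} [AddCommGroup E] [Module ℝ E]

/-- If `∑ j, g j • φ j = 0` with `g ≠ 0`, then `∑ j, g j * (r j - φ j p)` does not depend on `p`,
whereas the traces `{g > 0}` and `{g < 0}` would make it nonnegative and nonpositive, and not both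
zero. -/
theorem card_le_finrank_of_shatters [FiniteDimensional ℝ E] [DecidableEq ι] {φ : ι → Dual ℝ E}
    {r : ι → ℝ} {𝒜 : Finset (Finset ι)} (h𝒜 : ∀ A ∈ 𝒜, ∃ p, ∀ j, j ∈ A ↔ φ j p < r j)
    {L : Finset ι} (hL : 𝒜.Shatters L) : #L ≤ finrank ℝ E := by
  by_contra! hcard
  have hdep : ¬LinearIndependent ℝ fun j : L => φ j := fun h => by
    have hle := h.fintype_card_le_finrank
    rw [Subspace.dual_finrank_eq, Fintype.card_coe] at hle
    exact hcard.not_ge hle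
  obtain ⟨g, hg, j₀, hj₀⟩ := Fintype.not_linearIndependent_iff.1 hdep
  have htrace (P : L → Prop) : ∃ p, ∀ j : L, φ j p < r j ↔ P j := by
    classical
    obtain ⟨A, hA, hLA⟩ := hL (map_subtype_subset (univ.filter P))
    obtain ⟨p, hp⟩ := h𝒜 A hA
    refine ⟨p, fun j => ?_⟩
    have hj := Finset.ext_iff.1 hLA j
    simpa [hp] using hj
  obtain ⟨p, hp⟩ := htrace (0 < g ·)
  obtain ⟨q, hq⟩ := htrace (g · < 0)
  have hannihilate (p : E) : ∑ j, g j * φ j p = 0 := by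
    simpa using LinearMap.congr_fun hg p
  have hterm (j : L) : 0 ≤ g j * (φ j q - φ j p) := by
    rcases lt_trichotomy (g j) 0 with h | h | h
    · exact mul_nonneg_of_nonpos_of_nonpos h.le
        (by linarith [(hq j).2 h, not_lt.1 (mt (hp j).1 h.not_gt)])
    · simp [h]
    · exact mul_nonneg h.le (by linarith [(hp j).2 h, not_lt.1 (mt (hq j).1 h.not_gt)])
  have hstrict : g j₀ * (φ j₀ q - φ j₀ p) ≠ 0 := by
    refine mul_ne_zero hj₀ (sub_ne_zero.2 fun heq => ?_)
    rcases lt_or_gt_of_ne hj₀ with h | h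
    · exact h.not_gt ((hp j₀).1 (heq ▸ (hq j₀).2 h))
    · exact h.not_gt ((hq j₀).1 (heq ▸ (hp j₀).2 h))
  have hpos : 0 < ∑ j, g j * (φ j q - φ j p) :=
    sum_pos' (fun j _ => hterm j) ⟨j₀, mem_univ _, (hterm j₀).lt_of_ne' hstrict⟩
  simp only [mul_sub, sum_sub_distrib, hannihilate, sub_self, lt_irrefl] at hpos

/-- The functions `w · 1{φ p < r}` indexed by the points `p` of a vector space. -/
def thresholdClass (φ : α → Dual ℝ E) (r w : α → ℝ) : Set (α → ℝ) :=
  Set.range fun p => {i | φ i p < r i}.indicator w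

/-- `K` bounds the Rademacher complexity of the class `𝓕`: the expected supremum over `𝓕` of a
Rademacher sum along `k` points is at most `K √k`. The supremum is encoded by a selection of a
member of `𝓕` for each choice of signs. -/
def RademacherBounded (𝓕 : Set (α → ℝ)) (K : ℝ) : Prop :=
  ∀ (k : ℕ) (z : Fin k → α) (sel : (Fin k → Bool) → α → ℝ), (∀ ε, sel ε ∈ 𝓕) →
    𝔼 ε, |rademacherSum (sel ε ∘ z) ε| ≤ K * √k

theorem rademacherBounded_thresholdClass [FiniteDimensional ℝ E] [Nontrivial E]
    (φ : α → Dual ℝ E) (r : α → ℝ) {w : α → ℝ} {W : ℝ} (hw : ∀ i, |w i| ≤ W) (hW : 0 < W) :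
    RademacherBounded (thresholdClass φ r w) (20 * W * √(finrank ℝ E)) := by
  classical
  intro k z sel hsel
  obtain rfl | hk := k.eq_zero_or_pos
  · simp [rademacherSum]
  have : NeZero k := ⟨hk.ne'⟩
  choose p hp using hsel
  set 𝒜 : Finset (Finset (Fin k)) := univ.filter fun A => ∃ p, ∀ j, j ∈ A ↔ φ (z j) p < r (z j)
  set A : (Fin k → Bool) → Finset (Fin k) := fun ε => univ.filter fun j => φ (z j) (p ε) < r (z j)
  have hvc : 𝒜.vcDim ≤ finrank ℝ E := Finset.sup_le fun L hL =>
    card_le_finrank_of_shatters (φ := φ ∘ z) (r := r ∘ z) (fun A hA => (mem_filter.1 hA).2)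
      (mem_shatterer.1 hL)
  have hA (ε) : A ε ∈ 𝒜 := mem_filter.2 ⟨mem_univ _, p ε, fun j => by simp [A]⟩
  have hindicator (ε) : sel ε ∘ z = (A ε : Set (Fin k)).indicator (w ∘ z) := by
    ext j
    simp [← hp, A, Set.indicator_apply]
  calc 𝔼 ε, |rademacherSum (sel ε ∘ z) ε|
      = 𝔼 ε, |rademacherSum ((A ε : Set (Fin k)).indicator (w ∘ z)) ε| := by
        simp only [hindicator]
    _ ≤ 20 * W * √(finrank ℝ E * Fintype.card (Fin k)) :=
        expect_abs_rademacherSum_indicator_le (fun j => hw (z j)) hW hvc finrank_pos hA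
    _ = 20 * W * √(finrank ℝ E) * √k := by
        rw [Fintype.card_fin, Real.sqrt_mul (by positivity)]; ring

end Thresholds

section Symmetrization

open Equiv

theorem expect_perm_mul_right {α : Type*} [Fintype α] [DecidableEq α] (f : Perm α → ℝ)
    (τ : Perm α) : 𝔼 σ, f (σ * τ) = 𝔼 σ, f σ :=
  Fintype.expect_equiv (Equiv.mulRight τ) _ _ fun _ => rfl

theorem expect_perm_apply {α : Type*} [Fintype α] [DecidableEq α] (f : α → ℝ) (i : α) :
    𝔼 σ : Perm α, f (σ i) = 𝔼 j, f j := by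
  have : Nonempty α := ⟨i⟩
  have hindep (j) : 𝔼 σ : Perm α, f (σ j) = 𝔼 σ : Perm α, f (σ i) := by
    rw [← expect_perm_mul_right _ (swap i j)]
    simp only [Perm.mul_apply, swap_apply_right]
  calc 𝔼 σ : Perm α, f (σ i) = 𝔼 j, 𝔼 σ : Perm α, f (σ j) := by
        simp only [hindep, Fintype.expect_const]
    _ = 𝔼 σ : Perm α, 𝔼 j, f (σ j) := expect_comm ..
    _ = 𝔼 j, f j := by
        simp only [Fintype.expect_equiv (_ : Perm α) (fun _ => f _) f fun _ => rfl,
          Fintype.expect_const]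

theorem mul_abs_expect_sub_le {α κ : Type*} [Fintype α] [Fintype κ] {ψ : α → ℝ} {c B : ℝ}
    (e : κ → α) (h : ∀ τ : Perm α, |∑ j, (ψ (τ (e j)) - c)| ≤ B) :
    Fintype.card κ * |𝔼 i, ψ i - c| ≤ B := by
  classical
  have hrandom : 𝔼 τ : Perm α, ∑ j, (ψ (τ (e j)) - c) = Fintype.card κ * (𝔼 i, ψ i - c) := by
    simp only [expect_sum_comm, expect_sub_distrib, expect_perm_apply, Fintype.expect_const,
      sum_const, card_univ, nsmul_eq_mul]
  rw [← Nat.abs_cast, ← abs_mul, ← hrandom]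
  exact (abs_expect_le _ _).trans (expect_le univ_nonempty fun τ _ => h τ)

section Swap

variable {α : Type*} {k : ℕ}

/-- The permutation that exchanges `e (j, true)` and `e (j, false)` for all `j` with
`ε j = false`. -/
noncomputable def pairSwap (e : Fin k × Bool ↪ α) (ε : Fin k → Bool) : Perm α :=
  Perm.viaEmbedding (prodShear (Equiv.refl (Fin k))
    fun j => if ε j then Equiv.refl Bool else boolNot) e

theorem pairSwap_apply (e : Fin k × Bool ↪ α) (ε : Fin k → Bool) (j : Fin k) (b : Bool) :
    pairSwap e ε (e (j, b)) = e (j, if ε j then b else !b) := by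
  simp only [pairSwap, Perm.viaEmbedding_apply, prodShear_apply, Equiv.refl_apply]
  cases ε j <;> simp

/-- Symmetrization: exchanging the two members of a random set of pairs preserves the uniform
distribution of the arrival order and puts random signs in front of the differences, even when the
selected function depends on the whole order. -/
theorem abs_expect_sum_sub_le [Fintype α] [DecidableEq α] {𝓕 : Set (α → ℝ)} {K : ℝ}
    (h𝓕 : RademacherBounded 𝓕 K) {F : Perm α → α → ℝ} (hF : ∀ σ, F σ ∈ 𝓕) (e : Fin k × Bool ↪ α) :
    |𝔼 σ, ∑ j, (F σ (σ (e (j, true))) - F σ (σ (e (j, false))))| ≤ 2 * K * √k := by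
  set H : Perm α → ℝ := fun σ => ∑ j, (F σ (σ (e (j, true))) - F σ (σ (e (j, false))))
  set R : Bool → Perm α → (Fin k → Bool) → ℝ := fun b σ ε =>
    rademacherSum (F (σ * pairSwap e ε) ∘ fun j => σ (e (j, b))) ε
  have hsigns (σ ε) : H (σ * pairSwap e ε) = R true σ ε - R false σ ε := by
    simp only [H, R, rademacherSum, ← sum_sub_distrib, Perm.mul_apply, pairSwap_apply]
    refine sum_congr rfl fun j _ => ?_
    cases ε j <;> simp [sgn]; ring
  have hR (b σ) : 𝔼 ε, |R b σ ε| ≤ K * √k := h𝓕 k _ (fun ε => F (σ * pairSwap e ε)) fun ε => hF _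
  calc |𝔼 σ, H σ| = |𝔼 σ, 𝔼 ε, H (σ * pairSwap e ε)| := by
        rw [expect_comm]
        simp only [expect_perm_mul_right H, Fintype.expect_const]
    _ ≤ 𝔼 σ : Perm α, 𝔼 ε, (|R true σ ε| + |R false σ ε|) := by
        refine (abs_expect_le _ _).trans (expect_le_expect fun σ _ => ?_)
        refine (abs_expect_le _ _).trans (expect_le_expect fun ε _ => ?_)
        rw [hsigns]
        exact abs_sub _ _
    _ ≤ 2 * K * √k := by
        refine expect_le univ_nonempty fun σ _ => ?_
        rw [expect_add_distrib]
        linarith [hR true σ, hR false σ]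

end Swap

/-- A function that is fixed after `t` arrivals has nearly the same mean over these arrivals as at
the next one, since all later arrivals are exchangeable. -/
theorem abs_expect_prefix_sub_next_le {n k : ℕ} {𝓕 : Set (Fin n → ℝ)} {K : ℝ}
    (h𝓕 : RademacherBounded 𝓕 K) {F : Perm (Fin n) → Fin n → ℝ} (hF : ∀ σ, F σ ∈ 𝓕) {t : Fin n}
    (hprefix : ∀ σ σ' : Perm (Fin n), (∀ j < t, σ j = σ' j) → F σ = F σ')
    (hk : 0 < k) (hkt : k ≤ t) (hkn : t + k ≤ n) :
    |𝔼 σ, 𝔼 j : Fin t, F σ (σ (Fin.castLE t.isLt.le j)) - 𝔼 σ, F σ (σ t)| ≤ 2 * K / √k := by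
  set ψ : Fin n → ℝ := fun i => 𝔼 σ, F σ (σ i)
  have hexchange (i) (hi : t ≤ i) : ψ i = ψ t := by
    have hF' (σ) : F (σ * swap t i) = F σ := hprefix _ _ fun j hj => by
      rw [Perm.mul_apply, swap_apply_of_ne_of_ne hj.ne (hj.trans_le hi).ne]
    simp only [ψ]
    rw [← expect_perm_mul_right _ (swap t i)]
    simp only [hF', Perm.mul_apply, swap_apply_right]
  have hpairs (τ : Perm (Fin t)) :
      |∑ j : Fin k, (ψ (Fin.castLE t.isLt.le (τ (Fin.castLE hkt j))) - ψ t)| ≤ 2 * K * √k := by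
    let e : Fin k × Bool ↪ Fin n :=
      ⟨fun x => if x.2 then Fin.castLE t.isLt.le (τ (Fin.castLE hkt x.1)) else
        Fin.castLE hkn (Fin.natAdd t x.1), by
        rintro ⟨a, _ | _⟩ ⟨b, _ | _⟩ h <;>
          simp only [Bool.false_eq_true, if_false, if_true, Fin.ext_iff, Fin.val_castLE,
            Fin.val_natAdd] at h
        · exact Prod.ext (Fin.ext (Nat.add_left_cancel h)) rfl
        · omega
        · omega
        · exact Prod.ext (Fin.castLE_injective hkt (τ.injective (Fin.ext h))) rfl⟩
    have hsym := abs_expect_sum_sub_le h𝓕 hF e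
    simp only [expect_sum_comm, expect_sub_distrib] at hsym
    convert hsym using 4 with j
    · rfl
    · exact (hexchange (e (j, false)) (Fin.le_def.2 (Nat.le_add_right t j))).symm
  have hmean := mul_abs_expect_sub_le (ψ := fun j => ψ (Fin.castLE t.isLt.le j)) _ hpairs
  rw [Fintype.card_fin] at hmean
  have hk' : (0 : ℝ) < k := mod_cast hk
  rw [expect_comm]
  calc |𝔼 j : Fin t, ψ (Fin.castLE t.isLt.le j) - ψ t| ≤ 2 * K * √k / k :=
        (le_div_iff₀' hk').2 hmean
    _ = 2 * K / √k := by rw [mul_div_assoc, Real.sqrt_div_self', mul_one_div]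

end Symmetrization

section Dual

open Filter Topology

open Classical in
/-- The decision on a column at a given price: `1` if the column is accepted and `0` otherwise. -/
noncomputable def accept {m : ℕ} (c : Column m) (p : Fin m → ℝ) : ℝ :=
  if cost c p < c.1 then 1 else 0

open Classical in
/-- The columns on whose acceptance the price `p` is indifferent. -/
noncomputable def ties {m t : ℕ} (z : Fin t → Column m) (p : Fin m → ℝ) : Finset (Fin t) :=
  univ.filter fun j => cost (z j) p = (z j).1

variable {m t : ℕ} {d : Fin m → ℝ} {z : Fin t → Column m} {p : Fin m → ℝ}

theorem accept_mem_Icc (c : Column m) (p : Fin m → ℝ) : accept c p ∈ Set.Icc 0 1 := by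
  unfold accept
  split_ifs <;> simp

theorem cost_add_smul (c : Column m) (p v : Fin m → ℝ) (s : ℝ) :
    cost c (p + s • v) = cost c p + s * cost c v := by
  change c.2 ⬝ᵥ (p + s • v) = c.2 ⬝ᵥ p + s * c.2 ⬝ᵥ v
  rw [dotProduct_add, dotProduct_smul, smul_eq_mul]

theorem dualObjective_eq (d : Fin m → ℝ) (z : Fin t → Column m) (p : Fin m → ℝ) :
    dualObjective d z p = d ⬝ᵥ p + 𝔼 j, max ((z j).1 - cost (z j) p) 0 := by
  rw [dualObjective, Fintype.expect_eq_sum_div_card, Fintype.card_fin, one_div_mul_eq_div]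
  rfl

theorem max_sub_cost_eq (c : Column m) (p : Fin m → ℝ) :
    max (c.1 - cost c p) 0 = c.1 * accept c p - cost c p * accept c p := by
  unfold accept
  split_ifs with h
  · rw [max_eq_left (by linarith)]; ring
  · rw [max_eq_right (by linarith)]; ring

theorem eventually_max_sub_mul_le (x u : ℝ) :
    ∀ᶠ s in 𝓝[>] 0, max (x - s * u) 0 ≤
      max x 0 - s * (if 0 < x then u else 0) + s * (if x = 0 then |u| else 0) := by
  have hcont : Tendsto (fun s => x - s * u) (𝓝[>] 0) (𝓝 x) := by
    have h : Continuous fun s => x - s * u := by fun_prop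
    simpa using (h.tendsto 0).mono_left nhdsWithin_le_nhds
  rcases lt_trichotomy x 0 with h | rfl | h
  · filter_upwards [hcont.eventually_lt_const h] with s hs
    simp [h.not_gt, h.ne, h.le, hs.le]
  · filter_upwards [self_mem_nhdsWithin] with s hs
    simp only [zero_sub, max_self, lt_irrefl, if_false, mul_zero, sub_zero, if_true, zero_add]
    exact max_le (by nlinarith [neg_le_abs u, Set.mem_Ioi.1 hs])
      (mul_nonneg (Set.mem_Ioi.1 hs).le (abs_nonneg u))
  · filter_upwards [hcont.eventually_const_lt h] with s hs
    simp [h, h.ne', h.le, hs.le]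

/-- Tied columns are the kinks of the dual objective, where its directional derivative is off by at
most the size of the tied term. -/
theorem IsDualOptimal.expect_cost_mul_accept_le (hp : IsDualOptimal d z p) {v : Fin m → ℝ}
    (hv : ∀ᶠ s : ℝ in 𝓝[>] 0, 0 ≤ p + s • v) {B : ℝ} (hB : ∀ j ∈ ties z p, |cost (z j) v| ≤ B) :
    𝔼 j, cost (z j) v * accept (z j) p ≤ d ⬝ᵥ v + B * (#(ties z p) / t) := by
  classical
  have hterm (j) := eventually_max_sub_mul_le ((z j).1 - cost (z j) p) (cost (z j) v)
  obtain ⟨s, ⟨hfeasible, hterm⟩, hs⟩ :=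
    ((hv.and (eventually_all.2 hterm)).and self_mem_nhdsWithin).exists
  have hmean : 𝔼 j, max ((z j).1 - cost (z j) (p + s • v)) 0 ≤
      𝔼 j, max ((z j).1 - cost (z j) p) 0 - s * 𝔼 j, cost (z j) v * accept (z j) p +
        s * 𝔼 j, if j ∈ ties z p then |cost (z j) v| else 0 := by
    simp only [mul_expect, ← expect_sub_distrib, ← expect_add_distrib]
    refine expect_le_expect fun j _ => ?_
    simpa only [cost_add_smul, sub_add_eq_sub_sub, sub_pos, sub_eq_zero, accept, ties, mem_filter,
      mem_univ, true_and, mul_ite, mul_one, mul_zero, eq_comm (a := (z j).1)] using hterm j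
  have hties : 𝔼 j, (if j ∈ ties z p then |cost (z j) v| else 0) ≤ B * (#(ties z p) / t) := by
    rw [Fintype.expect_eq_sum_div_card, Fintype.card_fin, ← mul_div_assoc, mul_comm B]
    gcongr
    rw [← sum_filter, filter_mem_eq_inter, univ_inter, ← nsmul_eq_mul]
    exact sum_le_card_nsmul _ _ _ hB
  have hopt := hp.2 _ hfeasible
  rw [dualObjective_eq, dualObjective_eq, dotProduct_add, dotProduct_smul, smul_eq_mul] at hopt
  have hs : 0 < s := hs
  refine le_of_mul_le_mul_left ?_ hs
  linarith [mul_le_mul_of_nonneg_left hties hs.le]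

theorem IsDualOptimal.expect_consumption_le (hp : IsDualOptimal d z p) {W : ℝ} (i : Fin m)
    (hW : ∀ j, |(z j).2 i| ≤ W) :
    𝔼 j, (z j).2 i * accept (z j) p ≤ d i + W * (#(ties z p) / t) := by
  have hcost (c : Column m) : cost c (Pi.single i 1) = c.2 i := dotProduct_single_one c.2 i
  have hfeasible : ∀ᶠ s : ℝ in 𝓝[>] 0, 0 ≤ p + s • Pi.single i (1 : ℝ) := by
    filter_upwards [self_mem_nhdsWithin] with s hs
    exact add_nonneg hp.1 (smul_nonneg (Set.mem_Ioi.1 hs).le (Pi.single_nonneg.2 zero_le_one))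
  simpa only [hcost, dotProduct_single_one] using
    hp.expect_cost_mul_accept_le hfeasible fun j _ => by rw [hcost]; exact hW j

theorem IsDualOptimal.dualObjective_le (hp : IsDualOptimal d z p) {W : ℝ}
    (hW : ∀ j, |(z j).1| ≤ W) :
    dualObjective d z p ≤ 𝔼 j, (z j).1 * accept (z j) p + W * (#(ties z p) / t) := by
  have hcost (c : Column m) : cost c (-p) = -cost c p := dotProduct_neg c.2 p
  have hfeasible : ∀ᶠ s : ℝ in 𝓝[>] 0, 0 ≤ p + s • -p := by
    filter_upwards [Ioo_mem_nhdsGT (zero_lt_one' ℝ)] with s hs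
    have h := smul_nonneg (sub_nonneg.2 hs.2.le) (show 0 ≤ p from hp.1)
    rwa [sub_smul, one_smul, sub_eq_add_neg, ← smul_neg] at h
  have hstationary := hp.expect_cost_mul_accept_le hfeasible (B := W) fun j hj => by
    rw [hcost, abs_neg, (mem_filter.1 hj).2]
    exact hW j
  simp only [hcost, neg_mul, expect_neg_distrib, dotProduct_neg] at hstationary
  simp only [dualObjective_eq, max_sub_cost_eq, expect_sub_distrib]
  linarith

theorem IsDualOptimal.sum_le_div (hp : IsDualOptimal d z p) (ht : 0 < t) {W dlow : ℝ}
    (hW : ∀ j, (z j).1 ≤ W) (hW₀ : 0 ≤ W) (hdlow : 0 < dlow) (hd : ∀ i, dlow ≤ d i) :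
    ∑ i, p i ≤ W / dlow := by
  have : Nonempty (Fin t) := ⟨⟨0, ht⟩⟩
  rw [le_div_iff₀' hdlow]
  calc dlow * ∑ i, p i ≤ d ⬝ᵥ p := by
        rw [mul_sum]
        exact sum_le_sum fun i _ => mul_le_mul_of_nonneg_right (hd i) (hp.1 i)
    _ ≤ dualObjective d z p := by
        rw [dualObjective_eq]
        exact le_add_of_nonneg_right (expect_nonneg fun j _ => le_max_right _ _)
    _ ≤ dualObjective d z 0 := hp.2 0 fun _ => le_rfl
    _ ≤ W := by
        rw [dualObjective_eq, dotProduct_zero, zero_add]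
        refine expect_le univ_nonempty fun j _ => max_le ?_ hW₀
        simpa [cost] using hW j

theorem expect_reward_le_dualObjective_add (hp : 0 ≤ p) {x : Fin t → ℝ}
    (hx : ∀ j, 0 ≤ x j ∧ x j ≤ 1) {ε : ℝ} (hε : ∀ i, 𝔼 j, (z j).2 i * x j ≤ d i + ε) :
    𝔼 j, (z j).1 * x j ≤ dualObjective d z p + ε * ∑ i, p i := by
  have hterm (j) : (z j).1 * x j ≤ max ((z j).1 - cost (z j) p) 0 + cost (z j) p * x j := by
    have h := mul_le_mul_of_nonneg_right (le_max_left ((z j).1 - cost (z j) p) 0) (hx j).1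
    linarith [mul_le_of_le_one_right (le_max_right ((z j).1 - cost (z j) p) 0) (hx j).2]
  have hcost : 𝔼 j, cost (z j) p * x j = ∑ i, (𝔼 j, (z j).2 i * x j) * p i := by
    simp only [cost, sum_mul, expect_mul, ← expect_sum_comm]
    exact expect_congr rfl fun j _ => sum_congr rfl fun i _ => mul_right_comm ..
  calc 𝔼 j, (z j).1 * x j
      ≤ 𝔼 j, max ((z j).1 - cost (z j) p) 0 + ∑ i, (𝔼 j, (z j).2 i * x j) * p i := by
        rw [← hcost, ← expect_add_distrib]
        exact expect_le_expect fun j _ => hterm j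
    _ ≤ 𝔼 j, max ((z j).1 - cost (z j) p) 0 + ∑ i, (d i + ε) * p i := by
        gcongr with i
        exacts [hp i, hε i]
    _ = dualObjective d z p + ε * ∑ i, p i := by
        simp only [dualObjective_eq, add_mul, sum_add_distrib, mul_sum, dotProduct]
        ring

theorem IsDualOptimal.expect_reward_le (hp : IsDualOptimal d z p) (ht : 0 < t) {W dlow : ℝ}
    (hW : ∀ j, |(z j).1| ≤ W) (hdlow : 0 < dlow) (hd : ∀ i, dlow ≤ d i) {x : Fin t → ℝ}
    (hx : ∀ j, 0 ≤ x j ∧ x j ≤ 1) {ε : ℝ} (hε₀ : 0 ≤ ε)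
    (hε : ∀ i, 𝔼 j, (z j).2 i * x j ≤ d i + ε) :
    𝔼 j, (z j).1 * x j ≤
      𝔼 j, (z j).1 * accept (z j) p + W * (#(ties z p) / t) + ε * (W / dlow) := by
  have hW₀ : 0 ≤ W := (abs_nonneg _).trans (hW ⟨0, ht⟩)
  calc 𝔼 j, (z j).1 * x j ≤ dualObjective d z p + ε * ∑ i, p i :=
        expect_reward_le_dualObjective_add hp.1 hx hε
    _ ≤ _ := by
        gcongr
        exacts [hp.dualObjective_le hW,
          hp.sum_le_div ht (fun j => (le_abs_self _).trans (hW j)) hW₀ hdlow hd]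

theorem GeneralPosition.comp {n : ℕ} {D : Fin n → Column m} (hD : GeneralPosition D)
    {f : Fin t → Fin n} (hf : Function.Injective f) : GeneralPosition fun j => D (f j) := by
  classical
  intro p hp
  refine (card_le_card_of_injOn f (fun j hj => ?_) hf.injOn).trans (hD p hp)
  simpa using hj

theorem GeneralPosition.card_ties_div_le (hz : GeneralPosition z) (hp : 0 ≤ p) :
    (#(ties z p) / t : ℝ) ≤ √m / √t := by
  have hsq : (#(ties z p) * #(ties z p) : ℝ) ≤ m * t := by
    gcongr
    exacts [hz p hp, card_finset_fin_le _]
  rw [← Real.sqrt_div' _ t.cast_nonneg]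
  refine Real.le_sqrt_of_sq_le ?_
  obtain rfl | ht := t.eq_zero_or_pos
  · simp
  · rw [div_pow, div_le_div_iff₀ (by positivity) (by positivity)]
    nlinarith [t.cast_nonneg (α := ℝ)]

end Dual

section Sampling

open Equiv

variable {α κ ι : Type*} [Fintype α] [DecidableEq α] [Fintype κ] [Fintype ι]

theorem expect_sqrt_le_sqrt_expect {Ω : Type*} [Fintype Ω] [Nonempty Ω] {f : Ω → ℝ}
    (hf : 0 ≤ f) : 𝔼 ω, √(f ω) ≤ √(𝔼 ω, f ω) := by
  refine Real.le_sqrt_of_sq_le ?_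
  simpa only [Real.sq_sqrt (hf _)] using
    map_expect_le_of_convexOn (even_two.convexOn_pow (𝕜 := ℝ)) fun ω => Set.mem_univ (√(f ω))

theorem expect_perm_mul_nonpos {y : α → ℝ} (hy : ∑ j, y j = 0) {i l : α} (hil : i ≠ l) :
    𝔼 σ : Perm α, y (σ i) * y (σ l) ≤ 0 := by
  have hexchange : ∀ k ∈ univ.erase i,
      𝔼 σ : Perm α, y (σ i) * y (σ k) = 𝔼 σ : Perm α, y (σ i) * y (σ l) := fun k hk => by
    rw [← expect_perm_mul_right _ (swap l k)]
    simp only [Perm.mul_apply, swap_apply_right,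
      swap_apply_of_ne_of_ne hil (ne_of_mem_erase hk).symm]
  have htotal : ∑ k, 𝔼 σ : Perm α, y (σ i) * y (σ k) = 0 := by
    simp only [← expect_sum_comm, ← mul_sum, Equiv.sum_comp, hy, mul_zero, expect_const_zero]
  rw [← add_sum_erase _ _ (mem_univ i), sum_congr rfl hexchange, sum_const, nsmul_eq_mul]
    at htotal
  have hcard : (0 : ℝ) < #(univ.erase i) :=
    mod_cast card_pos.2 ⟨l, mem_erase.2 ⟨hil.symm, mem_univ _⟩⟩
  have hsq : 0 ≤ 𝔼 σ : Perm α, y (σ i) * y (σ i) := expect_nonneg fun σ _ => mul_self_nonneg _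
  exact nonpos_of_mul_nonpos_right (by linarith) hcard

theorem expect_sq_sample_sum_le {y : α → ℝ} (hy : ∑ j, y j = 0) (e : κ ↪ α) :
    𝔼 σ : Perm α, (∑ j, y (σ (e j))) ^ 2 ≤ Fintype.card κ * 𝔼 i, y i ^ 2 := by
  classical
  have hterm (i l : κ) :
      𝔼 σ : Perm α, y (σ (e i)) * y (σ (e l)) ≤ if i = l then 𝔼 i, y i ^ 2 else 0 := by
    split_ifs with h
    · simp only [h, ← sq, expect_perm_apply (fun i => y i ^ 2), le_refl]
    · exact expect_perm_mul_nonpos hy (e.injective.ne h)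
  simp only [sq (∑ _, _), sum_mul_sum, expect_sum_comm]
  refine (sum_le_sum fun i _ => sum_le_sum fun l _ => hterm i l).trans ?_
  simp

theorem expect_sq_sample_mean_sub_le (y : α → ℝ) [Nonempty κ] (e : κ ↪ α) :
    𝔼 σ : Perm α, (𝔼 j, y (σ (e j)) - 𝔼 i, y i) ^ 2 ≤ (𝔼 i, y i ^ 2) / Fintype.card κ := by
  have : Nonempty α := Nonempty.map e ‹_›
  set μ := 𝔼 i, y i with hμ
  have hκ : (0 : ℝ) < Fintype.card κ := mod_cast Fintype.card_pos
  have hcentered : ∑ i, (y i - μ) = 0 := by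
    rw [sum_sub_distrib, sum_const, card_univ, Fintype.card_smul_expect, sub_self]
  have hvariance : 𝔼 i, (y i - μ) ^ 2 ≤ 𝔼 i, y i ^ 2 := by
    have h (i) : (y i - μ) ^ 2 = y i ^ 2 - 2 * μ * y i + μ ^ 2 := by ring
    simp only [h, expect_add_distrib, expect_sub_distrib, ← mul_expect, ← hμ, Fintype.expect_const]
    linarith [sq_nonneg μ]
  have hsum (σ : Perm α) :
      (𝔼 j, y (σ (e j)) - μ) ^ 2 = (∑ j, (y (σ (e j)) - μ)) ^ 2 / Fintype.card κ ^ 2 := by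
    rw [← div_pow, ← Fintype.expect_eq_sum_div_card, expect_sub_distrib, Fintype.expect_const]
  simp only [hsum, ← expect_div]
  rw [sq (Fintype.card κ : ℝ), ← div_div]
  gcongr
  rw [div_le_iff₀' hκ]
  exact (expect_sq_sample_sum_le hcentered e).trans (by gcongr)

theorem expect_sqrt_sum_sq_sample_mean_sub_le {y : ι → α → ℝ} {W : ℝ} (hy : ∀ i j, |y i j| ≤ W)
    (hW : 0 ≤ W) [Nonempty κ] (e : κ ↪ α) :
    𝔼 σ : Perm α, √(∑ i, (𝔼 j, y i (σ (e j)) - 𝔼 j, y i j) ^ 2) ≤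
      W * (√(Fintype.card ι) / √(Fintype.card κ)) := by
  have : Nonempty α := Nonempty.map e ‹_›
  have hsecond (i) : 𝔼 j, y i j ^ 2 ≤ W ^ 2 :=
    expect_le univ_nonempty fun j _ => sq_le_sq' (abs_le.1 (hy i j)).1 (abs_le.1 (hy i j)).2
  calc 𝔼 σ : Perm α, √(∑ i, (𝔼 j, y i (σ (e j)) - 𝔼 j, y i j) ^ 2)
      ≤ √(𝔼 σ : Perm α, ∑ i, (𝔼 j, y i (σ (e j)) - 𝔼 j, y i j) ^ 2) :=
        expect_sqrt_le_sqrt_expect fun σ => sum_nonneg fun i _ => sq_nonneg _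
    _ ≤ √(∑ _i : ι, W ^ 2 / Fintype.card κ) := by
        rw [expect_sum_comm]
        gcongr with i
        exact (expect_sq_sample_mean_sub_le (y i) e).trans (by gcongr; exact hsecond i)
    _ = W * (√(Fintype.card ι) / √(Fintype.card κ)) := by
        rw [sum_const, card_univ, nsmul_eq_mul, mul_div_left_comm, Real.sqrt_mul (sq_nonneg W),
          Real.sqrt_sq hW, Real.sqrt_div (Nat.cast_nonneg _)]

end Sampling

section Rate

/-- The decay of the loss in the period `t` of `n`, up to a factor `√m`: the price is learned from
`t` arrivals and compared with `n - t` exchangeable later ones. The shift to `t + 1` keeps the first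
period, which has no arrivals to learn from, within the same bound. -/
noncomputable def rate (n t : ℕ) : ℝ := 1 / √(t + 1) + 1 / √(n - t)

theorem rate_nonneg (n t : ℕ) : 0 ≤ rate n t := by
  unfold rate
  positivity

theorem one_le_rate_zero (n : ℕ) : 1 ≤ rate n 0 := by
  simp [rate]

theorem one_div_sqrt_le_two_mul_rate (n : ℕ) {t : ℕ} (ht : 0 < t) : 1 / √t ≤ 2 * rate n t := by
  have ht' : (1 : ℝ) ≤ t := mod_cast ht
  have hsqrt : √((t : ℝ) + 1) ≤ 2 * √t := by
    rw [Real.sqrt_le_left (by positivity), mul_pow, Real.sq_sqrt (by positivity)]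
    linarith
  calc 1 / √t ≤ 2 * (1 / √(t + 1)) := by
        rw [mul_one_div, div_le_div_iff₀ (by positivity) (by positivity)]
        linarith
    _ ≤ 2 * rate n t := by
        unfold rate
        gcongr
        exact le_add_of_nonneg_right (by positivity)

theorem one_div_sqrt_min_le_two_mul_rate {n t : ℕ} (ht : 0 < t) (htn : t ≤ n) :
    1 / √(min t (n - t) : ℕ) ≤ 2 * rate n t := by
  rcases min_choice t (n - t) with h | h <;> rw [h]
  · exact one_div_sqrt_le_two_mul_rate n ht
  · have h₁ : 1 / √((n - t : ℕ) : ℝ) ≤ rate n t := by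
      rw [Nat.cast_sub htn]
      exact le_add_of_nonneg_left (by positivity)
    linarith [rate_nonneg n t]

theorem sum_one_div_sqrt_le (n : ℕ) : ∑ t ∈ range n, 1 / √((t : ℝ) + 1) ≤ 2 * √n := by
  have hstep (t : ℕ) : 1 / √((t : ℝ) + 1) ≤ 2 * √((t + 1 : ℕ) : ℝ) - 2 * √t := by
    rw [Nat.cast_add_one, div_le_iff₀ (by positivity)]
    nlinarith [Real.sq_sqrt (by positivity : (0 : ℝ) ≤ t + 1), Real.sq_sqrt t.cast_nonneg,
      sq_nonneg (√((t : ℝ) + 1) - √t)]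
  calc ∑ t ∈ range n, 1 / √((t : ℝ) + 1) ≤ ∑ t ∈ range n, (2 * √((t + 1 : ℕ) : ℝ) - 2 * √t) :=
        sum_le_sum fun t _ => hstep t
    _ = 2 * √n := by simp [sum_range_sub fun t : ℕ => 2 * √(t : ℝ), -Nat.cast_add]

theorem sum_rate_le (n : ℕ) : ∑ t : Fin n, rate n t ≤ 4 * √n := by
  have hreflect : ∑ t ∈ range n, 1 / √((n : ℝ) - t) = ∑ t ∈ range n, 1 / √((t : ℝ) + 1) := by
    rw [← sum_range_reflect]
    refine sum_congr rfl fun t ht => ?_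
    have ht : t + 1 ≤ n := mem_range.1 ht
    rw [Nat.sub_sub, add_comm 1 t, Nat.cast_sub ht, sub_sub_cancel, Nat.cast_add_one]
  rw [Fin.sum_univ_eq_sum_range (rate n)]
  simp only [rate, sum_add_distrib, hreflect]
  linarith [sum_one_div_sqrt_le n]

theorem sum_le_sum_add_of_le_add_rate {n : ℕ} {f g : Fin n → ℝ} {c : ℝ} (hc : 0 ≤ c)
    (h : ∀ t, f t ≤ g t + c * rate n t) : ∑ t, f t ≤ ∑ t, g t + 4 * c * √n :=
  calc ∑ t, f t ≤ ∑ t, g t + c * ∑ t : Fin n, rate n t := by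
        rw [mul_sum, ← sum_add_distrib]
        exact sum_le_sum fun t _ => h t
    _ ≤ ∑ t, g t + c * (4 * √n) := by gcongr; exact sum_rate_le n
    _ = ∑ t, g t + 4 * c * √n := by ring

end Rate

section Regret

open Equiv

variable {m n : ℕ} {D : Fin n → Column m} {d : Fin m → ℝ} {W dlow : ℝ}
  {solve : (t : ℕ) → (Fin t → Column m) → Fin m → ℝ}

theorem dlaPrice_congr {z z' : Fin n → Column m} {t : Fin n} (h : ∀ j < t, z j = z' j) :
    dlaPrice solve z t = dlaPrice solve z' t := by
  have hprefix : (fun j => z (Fin.castLE t.isLt.le j)) = fun j => z' (Fin.castLE t.isLt.le j) :=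
    funext fun j => h _ (Fin.lt_def.2 j.isLt)
  simp only [dlaPrice, hprefix]

theorem IsDualSolver.isDualOptimal_dlaPrice (hsolve : IsDualSolver d solve) {t : Fin n}
    (ht : 0 < (t : ℕ)) (z : Fin n → Column m) :
    IsDualOptimal d (fun j : Fin t => z (Fin.castLE t.isLt.le j)) (dlaPrice solve z t) := by
  rw [dlaPrice, if_neg ht.ne']
  exact hsolve _ _ ht

theorem accept_mem_thresholdClass (D : Fin n → Column m) (w : Fin n → ℝ) (p : Fin m → ℝ) :
    (fun i => w i * accept (D i) p) ∈
      thresholdClass (fun i => dotProductBilin ℝ ℝ (D i).2) (fun i => (D i).1) w := by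
  refine ⟨p, ?_⟩
  ext i
  change Set.indicator {i | cost (D i) p < (D i).1} w i = _
  simp [accept, Set.indicator_apply]

theorem abs_mul_le_of_mem_Icc {a x : ℝ} (ha : |a| ≤ W) (hx : x ∈ Set.Icc 0 1) : |a * x| ≤ W := by
  rw [abs_mul, abs_of_nonneg hx.1]
  exact (mul_le_of_le_one_right (abs_nonneg a) hx.2).trans ha

theorem abs_expect_sample_sub_next_le (hm : 1 ≤ m) (hW : 0 < W) {w : Fin n → ℝ}
    (hw : ∀ j, |w j| ≤ W) (D : Fin n → Column m)
    (solve : (t : ℕ) → (Fin t → Column m) → Fin m → ℝ) {t : Fin n} (ht : 0 < (t : ℕ)) :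
    |𝔼 σ : Perm (Fin n), 𝔼 j : Fin t, w (σ (Fin.castLE t.isLt.le j)) *
          accept (D (σ (Fin.castLE t.isLt.le j))) (dlaPrice solve (fun k => D (σ k)) t) -
        𝔼 σ : Perm (Fin n), w (σ t) * dlaOutput solve (fun k => D (σ k)) t| ≤
      80 * W * √m * rate n t := by
  have : Nonempty (Fin m) := ⟨⟨0, hm⟩⟩
  have hclass := rademacherBounded_thresholdClass (fun i => dotProductBilin ℝ ℝ (D i).2)
    (fun i => (D i).1) hw hW
  rw [Module.finrank_fin_fun] at hclass
  refine (abs_expect_prefix_sub_next_le (k := min t (n - t)) hclass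
    (F := fun σ i => w i * accept (D i) (dlaPrice solve (fun k => D (σ k)) t))
    (fun σ => accept_mem_thresholdClass ..) (fun σ σ' h => ?_) (by omega) (by omega)
    (by omega)).trans ?_
  · simp only [dlaPrice_congr fun j hj => congrArg D (h j hj)]
  · calc 2 * (20 * W * √m) / √(min t (n - t) : ℕ)
        = 40 * W * √m * (1 / √(min t (n - t) : ℕ)) := by ring
      _ ≤ 40 * W * √m * (2 * rate n t) := by
        gcongr
        exact one_div_sqrt_min_le_two_mul_rate ht t.isLt.le
      _ = 80 * W * √m * rate n t := by ring

theorem le_mul_sqrt_mul_rate_zero (hm : 1 ≤ m) {c : ℝ} (hc : 0 ≤ c) : c ≤ c * √m * rate n 0 := by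
  have hm' : 1 ≤ √(m : ℝ) := Real.one_le_sqrt.2 (mod_cast hm)
  calc c = c * 1 * 1 := by ring
    _ ≤ c * √m * rate n 0 := by gcongr; exact one_le_rate_zero n

theorem sqrt_div_sqrt_le (n : ℕ) {t : ℕ} (ht : 0 < t) : √m / √t ≤ 2 * √m * rate n t := by
  have h := mul_le_mul_of_nonneg_left (one_div_sqrt_le_two_mul_rate n ht) (Real.sqrt_nonneg m)
  rw [mul_one_div] at h
  linarith

theorem expect_next_consumption_le (hm : 1 ≤ m) (hW : 0 < W) (hWa : ∀ j i, |(D j).2 i| ≤ W)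
    (hd : ∀ i, 0 ≤ d i) (hD : GeneralPosition D) (hsolve : IsDualSolver d solve) (i : Fin m)
    (t : Fin n) :
    𝔼 σ : Perm (Fin n), (D (σ t)).2 i * dlaOutput solve (fun k => D (σ k)) t ≤
      d i + 82 * W * √m * rate n t := by
  obtain ht | ht := (t : ℕ).eq_zero_or_pos
  · have hfirst : 𝔼 σ : Perm (Fin n), (D (σ t)).2 i * dlaOutput solve (fun k => D (σ k)) t ≤ W :=
      expect_le univ_nonempty fun σ _ =>
        (le_abs_self _).trans (abs_mul_le_of_mem_Icc (hWa _ i) (accept_mem_Icc _ _))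
    have hrate := le_mul_sqrt_mul_rate_zero (n := n) hm (by positivity : 0 ≤ 82 * W)
    rw [ht]
    linarith [hd i]
  · have hsample : 𝔼 σ : Perm (Fin n), 𝔼 j : Fin t, (D (σ (Fin.castLE t.isLt.le j))).2 i *
        accept (D (σ (Fin.castLE t.isLt.le j))) (dlaPrice solve (fun k => D (σ k)) t) ≤
        d i + W * (√m / √t) := by
      refine expect_le univ_nonempty fun σ _ => ?_
      have hopt := hsolve.isDualOptimal_dlaPrice ht fun k => D (σ k)
      refine (hopt.expect_consumption_le i fun j => hWa _ i).trans ?_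
      gcongr d i + W * ?_
      exact (hD.comp (σ.injective.comp (Fin.castLE_injective _))).card_ties_div_le hopt.1
    have hnext := abs_expect_sample_sub_next_le hm hW (fun j => hWa j i) D solve ht
    linarith [(abs_le.1 hnext).1,
      mul_le_mul_of_nonneg_left (sqrt_div_sqrt_le (m := m) n ht) hW.le]

theorem expect_sample_reward_le (hdlow : 0 < dlow) (hWr : ∀ j, |(D j).1| ≤ W)
    (hd : ∀ i, dlow ≤ d i) (hD : GeneralPosition D) (hsolve : IsDualSolver d solve)
    {x : Fin n → ℝ} (hx : ∀ j, 0 ≤ x j ∧ x j ≤ 1) (hbudget : ∀ i, 𝔼 j, (D j).2 i * x j ≤ d i)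
    {t : Fin n} (ht : 0 < (t : ℕ)) (σ : Perm (Fin n)) :
    𝔼 j : Fin t, (D (σ (Fin.castLE t.isLt.le j))).1 * x (σ (Fin.castLE t.isLt.le j)) ≤
      𝔼 j : Fin t, (D (σ (Fin.castLE t.isLt.le j))).1 *
          accept (D (σ (Fin.castLE t.isLt.le j))) (dlaPrice solve (fun k => D (σ k)) t) +
        W * (√m / √t) +
        √(∑ i, (𝔼 j : Fin t, (D (σ (Fin.castLE t.isLt.le j))).2 i *
          x (σ (Fin.castLE t.isLt.le j)) - 𝔼 j, (D j).2 i * x j) ^ 2) * (W / dlow) := by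
  have hopt := hsolve.isDualOptimal_dlaPrice ht fun k => D (σ k)
  set dev : Fin m → ℝ := fun i => 𝔼 j : Fin t, (D (σ (Fin.castLE t.isLt.le j))).2 i *
    x (σ (Fin.castLE t.isLt.le j)) - 𝔼 j, (D j).2 i * x j
  have hsample (i) : 𝔼 j : Fin t, (D (σ (Fin.castLE t.isLt.le j))).2 i *
      x (σ (Fin.castLE t.isLt.le j)) ≤ d i + √(∑ i, dev i ^ 2) := by
    have h : dev i ≤ √(∑ i, dev i ^ 2) := Real.le_sqrt_of_sq_le <|
      single_le_sum (f := fun i => dev i ^ 2) (fun i _ => sq_nonneg _) (mem_univ i)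
    simp only [dev] at h ⊢
    linarith [hbudget i]
  have hW : 0 ≤ W := (abs_nonneg _).trans (hWr t)
  refine (hopt.expect_reward_le ht (fun j => hWr _) hdlow hd (fun j => hx _)
    (Real.sqrt_nonneg _) hsample).trans ?_
  gcongr _ + W * ?_ + _
  exact (hD.comp (σ.injective.comp (Fin.castLE_injective _))).card_ties_div_le hopt.1

theorem expect_le_expect_sample_reward_add (hdlow : 0 < dlow) (hWr : ∀ j, |(D j).1| ≤ W)
    (hWa : ∀ j i, |(D j).2 i| ≤ W) (hd : ∀ i, dlow ≤ d i) (hD : GeneralPosition D)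
    (hsolve : IsDualSolver d solve) {x : Fin n → ℝ} (hx : ∀ j, 0 ≤ x j ∧ x j ≤ 1)
    (hbudget : ∀ i, 𝔼 j, (D j).2 i * x j ≤ d i) {t : Fin n} (ht : 0 < (t : ℕ)) :
    𝔼 j, (D j).1 * x j ≤
      𝔼 σ : Perm (Fin n), 𝔼 j : Fin t, (D (σ (Fin.castLE t.isLt.le j))).1 *
          accept (D (σ (Fin.castLE t.isLt.le j))) (dlaPrice solve (fun k => D (σ k)) t) +
        (W + W * (W / dlow)) * (√m / √t) := by
  have hW : 0 ≤ W := (abs_nonneg _).trans (hWr t)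
  have : Nonempty (Fin t) := ⟨⟨0, ht⟩⟩
  have hdeviation : 𝔼 σ : Perm (Fin n), √(∑ i, (𝔼 j : Fin t,
      (D (σ (Fin.castLE t.isLt.le j))).2 i * x (σ (Fin.castLE t.isLt.le j)) -
        𝔼 j, (D j).2 i * x j) ^ 2) ≤ W * (√m / √t) := by
    simpa only [Fintype.card_fin, Fin.castLEEmb_apply] using expect_sqrt_sum_sq_sample_mean_sub_le
      (fun i j => abs_mul_le_of_mem_Icc (hWa j i) (hx j)) hW (Fin.castLEEmb t.isLt.le)
  have hreward : 𝔼 σ : Perm (Fin n), 𝔼 j : Fin t, (D (σ (Fin.castLE t.isLt.le j))).1 *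
      x (σ (Fin.castLE t.isLt.le j)) = 𝔼 j, (D j).1 * x j := by
    rw [expect_comm]
    simp only [expect_perm_apply (fun j => (D j).1 * x j), Fintype.expect_const]
  have hsample := expect_le_expect fun σ (_ : σ ∈ univ) =>
    expect_sample_reward_le hdlow hWr hd hD hsolve hx hbudget ht σ
  rw [hreward, expect_add_distrib, expect_add_distrib, Fintype.expect_const, ← expect_mul]
    at hsample
  have hvalue := mul_le_mul_of_nonneg_right hdeviation (by positivity : 0 ≤ W / dlow)
  linarith

/-- The constant in the reward loss per period: `82 = 2 (2 · 20 + 1)` collects the sampling error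
and the ties, and the second term the deviation of the sample consumption, valued at prices whose
sum is at most `W / dlow`. -/
noncomputable def lossConst (W dlow : ℝ) : ℝ := 82 * W + 2 * (W * (W / dlow))

theorem expect_le_expect_next_reward_add (hm : 1 ≤ m) (hW : 0 < W) (hdlow : 0 < dlow)
    (hWr : ∀ j, |(D j).1| ≤ W) (hWa : ∀ j i, |(D j).2 i| ≤ W) (hd : ∀ i, dlow ≤ d i)
    (hD : GeneralPosition D) (hsolve : IsDualSolver d solve) {x : Fin n → ℝ}
    (hx : ∀ j, 0 ≤ x j ∧ x j ≤ 1) (hbudget : ∀ i, 𝔼 j, (D j).2 i * x j ≤ d i) (t : Fin n) :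
    𝔼 j, (D j).1 * x j ≤
      𝔼 σ : Perm (Fin n), (D (σ t)).1 * dlaOutput solve (fun k => D (σ k)) t +
        lossConst W dlow * √m * rate n t := by
  have hprice : 0 ≤ W * (W / dlow) := by positivity
  obtain ht | ht := (t : ℕ).eq_zero_or_pos
  · have : Nonempty (Fin n) := ⟨t⟩
    have hbest : 𝔼 j, (D j).1 * x j ≤ W := expect_le univ_nonempty fun j _ =>
      (le_abs_self _).trans (abs_mul_le_of_mem_Icc (hWr j) (hx j))
    have hfirst : -W ≤ 𝔼 σ : Perm (Fin n), (D (σ t)).1 * dlaOutput solve (fun k => D (σ k)) t :=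
      le_expect univ_nonempty fun σ _ =>
        (abs_le.1 (abs_mul_le_of_mem_Icc (hWr _) (accept_mem_Icc _ _))).1
    have hrate := le_mul_sqrt_mul_rate_zero (n := n) hm (c := lossConst W dlow)
      (by unfold lossConst; positivity)
    rw [ht]
    have : 2 * W ≤ lossConst W dlow := by unfold lossConst; linarith
    linarith
  · have hsample := expect_le_expect_sample_reward_add hdlow hWr hWa hd hD hsolve hx hbudget ht
    have hnext := abs_expect_sample_sub_next_le hm hW hWr D solve ht
    have hrate := mul_le_mul_of_nonneg_left (sqrt_div_sqrt_le (m := m) n ht)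
      (by positivity : 0 ≤ W + W * (W / dlow))
    unfold lossConst
    linarith [(abs_le.1 hnext).2]

theorem primalValue_sub_expect_dlaReward_le (hm : 1 ≤ m) (hW : 0 < W) (hdlow : 0 < dlow)
    (hWr : ∀ j, |(D j).1| ≤ W) (hWa : ∀ j i, |(D j).2 i| ≤ W) (hd : ∀ i, dlow ≤ d i)
    (hD : GeneralPosition D) (hsolve : IsDualSolver d solve) :
    primalValue D (fun i => (n : ℝ) * d i) -
        𝔼 σ : Perm (Fin n), dlaReward solve (fun t => D (σ t)) ≤
      4 * lossConst W dlow * √(m * n) := by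
  have hC : 0 ≤ lossConst W dlow := by unfold lossConst; positivity
  have hzero : (0 : Fin n → ℝ) ∈ primalFeasible D fun i => (n : ℝ) * d i :=
    ⟨by simp, fun i => by simpa using mul_nonneg n.cast_nonneg (hdlow.le.trans (hd i))⟩
  rw [sub_le_iff_le_add]
  refine csSup_le ((Set.nonempty_of_mem hzero).image _) ?_
  rintro _ ⟨x, hx, rfl⟩
  have hbudget (t : Fin n) (i) : 𝔼 j, (D j).2 i * x j ≤ d i := by
    have hn : (0 : ℝ) < n := mod_cast t.pos
    rw [Fintype.expect_eq_sum_div_card, Fintype.card_fin, div_le_iff₀' hn]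
    exact hx.2 i
  have hsum := sum_le_sum_add_of_le_add_rate (by positivity) fun t =>
    expect_le_expect_next_reward_add hm hW hdlow hWr hWa hd hD hsolve hx.1 (hbudget t) t
  rw [sum_const, card_univ, Fintype.card_smul_expect, ← expect_sum_comm] at hsum
  calc ∑ j, (D j).1 * x j ≤ _ := hsum
    _ = 4 * lossConst W dlow * √(m * n) +
        𝔼 σ : Perm (Fin n), dlaReward solve (fun t => D (σ t)) := by
      rw [Real.sqrt_mul m.cast_nonneg]
      simp only [dlaReward]
      ring

theorem expect_dlaExcess_le (hm : 1 ≤ m) (hW : 0 < W) (hWa : ∀ j i, |(D j).2 i| ≤ W)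
    (hd : ∀ i, 0 ≤ d i) (hD : GeneralPosition D) (hsolve : IsDualSolver d solve) (i : Fin m) :
    𝔼 σ : Perm (Fin n), dlaExcess solve (fun t => D (σ t)) (fun i => (n : ℝ) * d i) i ≤
      4 * (82 * W) * √(m * n) := by
  have hsum := sum_le_sum_add_of_le_add_rate (by positivity) fun t =>
    expect_next_consumption_le hm hW hWa hd hD hsolve i t
  rw [← expect_sum_comm, sum_const, card_univ, Fintype.card_fin, nsmul_eq_mul] at hsum
  simp only [dlaExcess, expect_sub_distrib, Fintype.expect_const]
  rw [Real.sqrt_mul m.cast_nonneg]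
  linarith

end Regret

theorem le_two_mul_mul_log {n : ℕ} (hn : 2 ≤ n) {a : ℝ} (ha : 0 ≤ a) :
    a ≤ 2 * a * Real.log n := by
  have hlog : Real.log 2 ≤ Real.log n := Real.log_le_log (by norm_num) (mod_cast hn)
  nlinarith [Real.log_two_gt_d9]

end OnlineLP

theorem theorem4_general (rbar abar dlow : ℝ) (hdlow : 0 < dlow) :
    ∃ C : ℝ, 0 ≤ C ∧ ∀ (m n : ℕ), 1 ≤ m →
      ∀ (D : Fin n → OnlineLP.Column m) (d : Fin m → ℝ),
        (∀ j, |(D j).1| ≤ rbar) →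
        (∀ j i, |(D j).2 i| ≤ abar) →
        (∀ i, dlow ≤ d i) →
        OnlineLP.GeneralPosition D →
        ∀ solve : (t : ℕ) → (Fin t → OnlineLP.Column m) → (Fin m → ℝ),
          OnlineLP.IsDualSolver d solve →
          OnlineLP.primalValue D (fun i => (n : ℝ) * d i)
              - (𝔼 σ : Equiv.Perm (Fin n), OnlineLP.dlaReward solve (fun t => D (σ t)))
            ≤ C * √(m * n) ∧
          ∀ i : Fin m,
            (𝔼 σ : Equiv.Perm (Fin n),
              OnlineLP.dlaExcess solve (fun t => D (σ t)) (fun i => (n : ℝ) * d i) i)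
            ≤ C * √(m * n) := by
  set W := max 1 (max rbar abar)
  have hW : 0 < W := zero_lt_one.trans_le (le_max_left _ _)
  have hC : 82 * W ≤ OnlineLP.lossConst W dlow := le_add_of_nonneg_right (by positivity)
  refine ⟨4 * OnlineLP.lossConst W dlow, by linarith,
    fun m n hm D d hr ha hd hD solve hsolve => ?_⟩
  have hWr (j) : |(D j).1| ≤ W := (hr j).trans (by simp [W])
  have hWa (j i) : |(D j).2 i| ≤ W := (ha j i).trans (by simp [W])
  refine ⟨OnlineLP.primalValue_sub_expect_dlaReward_le hm hW hdlow hWr hWa hd hD hsolve,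
    fun i => ?_⟩
  refine (OnlineLP.expect_dlaExcess_le hm hW hWa (fun i => hdlow.le.trans (hd i)) hD hsolve
    i).trans ?_
  gcongr

theorem theorem4 (rbar abar dlow dbar : ℝ) (hdlow : 0 < dlow) :
    ∃ C : ℝ, ∀ (m n : ℕ), 1 ≤ m → 1 ≤ n →
      ∀ (D : Fin n → OnlineLP.Column m) (d : Fin m → ℝ),
        (∀ j, |(D j).1| ≤ rbar) →
        (∀ j i, |(D j).2 i| ≤ abar) →
        (∀ i, dlow ≤ d i ∧ d i ≤ dbar) →
        OnlineLP.GeneralPosition D →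
        ∀ solve : (t : ℕ) → (Fin t → OnlineLP.Column m) → (Fin m → ℝ),
          OnlineLP.IsDualSolver d solve →
          OnlineLP.primalValue D (fun i => (n : ℝ) * d i)
              - (𝔼 σ : Equiv.Perm (Fin n), OnlineLP.dlaReward solve (fun t => D (σ t)))
            ≤ C * Real.sqrt ((m : ℝ) * (n : ℝ)) ∧
          (2 ≤ n → ∀ i : Fin m,
            (𝔼 σ : Equiv.Perm (Fin n),
              OnlineLP.dlaExcess solve (fun t => D (σ t)) (fun i => (n : ℝ) * d i) i)
            ≤ C * (Real.sqrt ((m : ℝ) * (n : ℝ)) * Real.log (n : ℝ))) := by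
  obtain ⟨C, hC, h⟩ := theorem4_general rbar abar dlow hdlow
  refine ⟨2 * C, fun m n hm _ D d hr ha hd hD solve hsolve => ?_⟩
  obtain ⟨hregret, hexcess⟩ := h m n hm D d hr ha (fun i => (hd i).1) hD solve hsolve
  have hbound : 0 ≤ C * √(m * n) := by positivity
  exact ⟨by linarith, fun hn i => (hexcess i).trans (by
    linarith [OnlineLP.le_two_mul_mul_log hn hbound])⟩
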